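/- Let $\mathbb F_q$ be a finite field with algebraic closure $\overline{\mathbb F}_q$, and write $\mathbb A^n=\overline{\mathbb F}_q^{\,n}$. Let $s,d,r$ be positive integers with $1\le s\le d-2$, $2(s+1)\le d$ and $d-s+1\le r\le d$. Let $S_{d-s},\dots,S_{r-1}\in\mathbb F_q[Y_1,\dots,Y_s]$ be polynomials such that (H1) $S_{d-s},\dots,S_{r-1}$ form a regular sequence of $\mathbb F_q[Y_1,\dots,Y_s]$, in the sense that $S_{d-s}\ne 0$ and, for $d-s<j\le r-1$, multiplication by $S_j$ is injective on $\mathbb F_q[Y_1,\dots,Y_s]/(S_{d-s},\dots,S_{j-1})$ (the quotient is allowed to be zero); (H2) the Jacobian matrix $(\partial S_j/\partial Y_k)_{d-s\le j\le r-1,\,1\le k\le s}(\boldsymbol y)$ has full rank $r-d+s$ for every $\boldsymbol y\in\mathbb A^s$. Let $\Pi_1,\dots,\Pi_s$ be the first $s$ elementary symmetric polynomials of $\mathbb F_q[X_1,\dots,X_r]$, let $R_j:=S_j(\Pi_1,\dots,\Pi_s)$ for $d-s\le j\le r-1$, and let $V_r\subset\mathbb A^r$ be the affine variety of common zeros of $R_{d-s},\dots,R_{r-1}$.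 Then the set of points $\boldsymbol x\in\mathbb A^r$ at which the Jacobian matrix $(\partial R_j/\partial X_k)_{d-s\le j\le r-1,\,1\le k\le r}(\boldsymbol x)$ does not have full rank $r-d+s$ has dimension at most $s-1$. In particular, the singular locus of $V_r$ has dimension at most $s-1$. Here dimension is the Krull dimension for the Zariski topology on $\mathbb A^r$ (the supremum of the lengths of chains of irreducible closed subsets, the empty set having dimension $-\infty$), and both bounds hold for the Zariski topology whose closed sets are defined over $\mathbb F_q$ as well as for the one whose closed sets are defined over $\overline{\mathbb F}_q$. A point $\boldsymbol x$ of an affine variety $V\subset\mathbb A^r$ is singular if $\dim\mathcal T_{\boldsymbol x}V\ne\dim_{\boldsymbol x}V$, where $\mathcal T_{\boldsymbol x}V$ is the common kernel of the differentials at $\boldsymbol x$ of the polynomials in $\overline{\mathbb F}_q[X_1,\dots,X_r]$ vanishing on $V$, and $\dim_{\boldsymbol x}V$ is the largest dimension of an irreducible component of $V$ (over $\overline{\mathbb F}_q$) containing $\boldsymbol x$. -/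

import Mathlib

/-!
Affine `n`-space over `L` is `Fin n → L`. For a subfield `K` of `L` (given by `[Algebra K L]`), the
affine `K`-varieties are the common zero sets in `Fin n → L` of polynomials with coefficients in `K`.
-/

noncomputable section

namespace SymSing

/-- The Zariski `K`-topology on affine space `Fin n → L`: the closed sets are the affine
`K`-varieties. -/
@[reducible] def zariskiTopology (K L : Type*) [Field K] [Field L] [Algebra K L] (n : ℕ) :
    TopologicalSpace (Fin n → L) :=
  TopologicalSpace.ofClosed
    {Z | ∃ I : Ideal (MvPolynomial (Fin n) K), Z = MvPolynomial.zeroLocus L I}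
    ⟨⊤, by simp⟩
    (by
      intro A hA
      refine ⟨sSup {I | MvPolynomial.zeroLocus L I ∈ A}, ?_⟩
      apply Set.eq_of_subset_of_subset
      · intro x hx
        have h : sSup {I : Ideal (MvPolynomial (Fin n) K) | MvPolynomial.zeroLocus L I ∈ A} ≤
            RingHom.ker (MvPolynomial.aeval (R := K) x) :=
          sSup_le fun I hI p hp => hx _ hI p hp
        exact fun p hp => h hp
      · intro x hx Z hZ
        obtain ⟨I, rfl⟩ := hA hZ
        exact MvPolynomial.zeroLocus_anti_mono (le_sSup hZ) hx)
    (by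
      rintro _ ⟨I, rfl⟩ _ ⟨J, rfl⟩
      refine ⟨I * J, ?_⟩
      ext x
      constructor
      · rintro (h | h)
        · exact MvPolynomial.zeroLocus_anti_mono Ideal.mul_le_left h
        · exact MvPolynomial.zeroLocus_anti_mono Ideal.mul_le_right h
      · intro h
        by_contra hc
        simp only [Set.mem_union, MvPolynomial.mem_zeroLocus_iff, not_or, not_forall] at hc
        obtain ⟨⟨p, hp, hp'⟩, q, hq, hq'⟩ := hc
        have hpq := h (p * q) (Ideal.mul_mem_mul hp hq)
        rw [map_mul] at hpq
        exact (mul_eq_zero.mp hpq).elim hp' hq')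

/-- The dimension of a subset `V` of affine space with respect to the Zariski `K`-topology: the
supremum of the lengths of the chains of irreducible (nonempty) relatively closed subsets of `V`;
it is `⊥` exactly for the empty set. If `V` is a `K`-variety, these subsets are exactly the
irreducible `K`-varieties contained in `V`. -/
def dim (K : Type*) {L : Type*} [Field K] [Field L] [Algebra K L] {n : ℕ} (V : Set (Fin n → L)) :
    WithBot ℕ∞ :=
  @topologicalKrullDim V (TopologicalSpace.induced Subtype.val (zariskiTopology K L n))

/-- The affine variety `V(G₁, …, Gₘ)` of common zeros in `Fin n → L` of `G₁, …, Gₘ`. -/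
def variety {K : Type*} (L : Type*) [Field K] [Field L] [Algebra K L] {m n : ℕ}
    (G : Fin m → MvPolynomial (Fin n) K) : Set (Fin n → L) :=
  {x | ∀ i, MvPolynomial.aeval x (G i) = 0}

/-- The Jacobian matrix `(∂Gᵢ/∂Xⱼ)(x)` of `G₁, …, Gₘ` at the point `x`. -/
def jacobian {K L : Type*} [Field K] [Field L] [Algebra K L] {m n : ℕ}
    (G : Fin m → MvPolynomial (Fin n) K) (x : Fin n → L) : Matrix (Fin m) (Fin n) L :=
  Matrix.of fun i j => MvPolynomial.aeval x (MvPolynomial.pderiv j (G i))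

/-- The irreducible components of `V ⊆ Lⁿ` in the Zariski topology over `L`: the maximal
irreducible subsets of `V`. -/
def components {L : Type*} [Field L] {n : ℕ} (V : Set (Fin n → L)) : Set (Set (Fin n → L)) :=
  {C | Maximal (fun Z => @IsIrreducible _ (zariskiTopology L L n) Z ∧ Z ⊆ V) C}

/-- The dimension of `V` at `x`: the maximum of the dimensions of the irreducible components of `V`
that contain `x`. -/
def dimAt {L : Type*} [Field L] {n : ℕ} (V : Set (Fin n → L)) (x : Fin n → L) : WithBot ℕ∞ :=
  ⨆ C ∈ {C | C ∈ components V ∧ x ∈ C}, dim L C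

/-- The tangent space of `V` at `x`: the vectors `v` with `∑ⱼ (∂F/∂Xⱼ)(x) vⱼ = 0` for all `F` in the
defining ideal `I(V) ⊆ L[X₁, …, Xₙ]`. For `x ∈ V` this is the kernel of the Jacobian matrix at `x` of
any system of generators of `I(V)`. -/
def tangentSpace {L : Type*} [Field L] {n : ℕ} (V : Set (Fin n → L)) (x : Fin n → L) :
    Submodule L (Fin n → L) :=
  ⨅ F ∈ MvPolynomial.vanishingIdeal L V,
    LinearMap.ker (jacobian (fun _ : Fin 1 => F) x).mulVecLin

/-- The singular locus of `V`: the points `x ∈ V` at which the dimension of the tangent space differs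
from the dimension of `V` at `x`. -/
def singularLocus {L : Type*} [Field L] {n : ℕ} (V : Set (Fin n → L)) : Set (Fin n → L) :=
  {x | x ∈ V ∧ ((Module.finrank L (tangentSpace V x) : ℕ) : WithBot ℕ∞) ≠ dimAt V x}

/-- The polynomials `Rⱼ = Sⱼ(Π₁, …, Πₛ)`, where `Π₁, …, Πₛ` are the first `s` elementary symmetric
polynomials in `X₁, …, X_r`. -/
def symComp {F : Type*} [Field F] {m s : ℕ} (r : ℕ) (S : Fin m → MvPolynomial (Fin s) F) :
    Fin m → MvPolynomial (Fin r) F :=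
  fun j => MvPolynomial.bind₁ (fun i : Fin s => MvPolynomial.esymm (Fin r) F (i + 1)) (S j)

end SymSing

end

noncomputable section

namespace SymSing

open MvPolynomial

/-! ### Zariski topology: irreducible sets versus prime ideals, chains versus dimension -/

section Topology

variable {K L : Type*} [Field K] [Field L] [Algebra K L] {n : ℕ}

/-! By the chain rule the Jacobian of the `R_j` at `x` is (Jacobian of `S` at `Π(x)`) times
(Jacobian of `Π` at `x`). The first factor always has independent rows. In the second, the entry
`(i, k)` is the `i`-th elementary symmetric function of the coordinates other than `x k`; it is the
value at `x k` of a polynomial of degree `i` that does not depend on `k`. A relation between the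
rows is thus a polynomial of degree `< s` vanishing at every coordinate of `x`, so it is trivial
once `x` has `s` distinct coordinates (`linearIndependent_jacobian_esymm`). The bad points therefore
lie on finitely many diagonal subspaces of dimension at most `s - 1` (`dim_le_of_card_image_lt`).

For the singular locus it remains to prove the Jacobian criterion (`finrank_tangentSpace_eq_dimAt`):
where `m` equations in `n` variables have Jacobian rank `m`, both the tangent space and the local
dimension are `n - m`. Krull's height theorem gives `≥ n - m` for the local dimension; the height of
a point is at most its tangent dimension, which is at most `n - m` by rank-nullity. -/

theorem isClosed_zariski_iff {Z : Set (Fin n → L)} :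
    @IsClosed _ (zariskiTopology K L n) Z ↔ ∃ I : Ideal (MvPolynomial (Fin n) K),
      Z = zeroLocus L I := by
  let _ := zariskiTopology K L n
  rw [← isOpen_compl_iff]
  change Zᶜᶜ ∈ _ ↔ _
  rw [compl_compl]
  rfl

theorem isIrreducible_zariski_iff {Z : Set (Fin n → L)} :
    @IsIrreducible _ (zariskiTopology K L n) Z ↔ (vanishingIdeal K Z).IsPrime := by
  let _ := zariskiTopology K L n
  constructor
  · rintro ⟨⟨x, hx⟩, hZ⟩
    rw [isPreirreducible_iff_isClosed_union_isClosed] at hZ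
    refine ⟨fun h => ?_, fun {f g} hfg => ?_⟩
    · have h1 : (1 : MvPolynomial (Fin n) K) ∈ vanishingIdeal K Z := h ▸ Submodule.mem_top
      simpa using h1 x hx
    · have key := hZ (zeroLocus L (Ideal.span {f})) (zeroLocus L (Ideal.span {g}))
        (isClosed_zariski_iff.2 ⟨_, rfl⟩) (isClosed_zariski_iff.2 ⟨_, rfl⟩) (fun z hz => by
          have h := hfg z hz
          rw [map_mul, mul_eq_zero] at h
          simpa [zeroLocus_span] using h)
      rcases key with h | h
      · left
        intro z hz
        simpa [zeroLocus_span] using h hz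
      · right
        intro z hz
        simpa [zeroLocus_span] using h hz
  · intro hp
    refine ⟨?_, ?_⟩
    · rw [Set.nonempty_iff_ne_empty]
      rintro rfl
      exact hp.ne_top vanishingIdeal_empty
    · rw [isPreirreducible_iff_isClosed_union_isClosed]
      intro A B hA hB hAB
      obtain ⟨I, rfl⟩ := isClosed_zariski_iff.1 hA
      obtain ⟨J, rfl⟩ := isClosed_zariski_iff.1 hB
      have : I * J ≤ vanishingIdeal K Z := by
        rw [Ideal.mul_le]
        intro f hf g hg z hz
        rw [map_mul, mul_eq_zero]
        exact (hAB hz).imp (fun h => h f hf) (fun h => h g hg)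
      exact (hp.mul_le.1 this).imp le_zeroLocus_iff_le_vanishingIdeal.2
        le_zeroLocus_iff_le_vanishingIdeal.2

/-- The relatively closed irreducible subsets of `V` for the Zariski `K`-topology. -/
abbrev IrrClosedIn (K : Type*) {L : Type*} [Field K] [Field L] [Algebra K L] {n : ℕ}
    (V : Set (Fin n → L)) : Type _ :=
  @TopologicalSpace.IrreducibleCloseds V
    (TopologicalSpace.induced Subtype.val (zariskiTopology K L n))

/-- The prime ideal of the polynomials over `K` that vanish on an irreducible set. -/
def IrrClosedIn.prime {V : Set (Fin n → L)} (A : IrrClosedIn K V) :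
    PrimeSpectrum (MvPolynomial (Fin n) K) :=
  ⟨vanishingIdeal K (Subtype.val '' (A : Set V)), by
    let _ := zariskiTopology K L n
    exact isIrreducible_zariski_iff.1
      (A.isIrreducible.image Subtype.val continuous_subtype_val.continuousOn)⟩

/-- A relatively closed set is recovered from the polynomials vanishing on it, so no Nullstellensatz
is needed and upper bounds on `dim` hold over any `K` and `L`. -/
theorem IrrClosedIn.prime_strictAnti {V : Set (Fin n → L)} :
    StrictAnti (IrrClosedIn.prime : IrrClosedIn K V → _) := by
  let _ := zariskiTopology K L n
  have key : ∀ A B : IrrClosedIn K V, A.prime ≤ B.prime → B ≤ A := by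
    intro A B h z hz
    obtain ⟨Y, hY, hYA⟩ := isClosed_induced_iff.1 A.isClosed
    obtain ⟨I, rfl⟩ := isClosed_zariski_iff.1 hY
    change z ∈ (A : Set V)
    rw [← hYA]
    intro p hp
    refine h (show p ∈ vanishingIdeal K (Subtype.val '' (A : Set V)) from ?_) _ ⟨z, hz, rfl⟩
    rintro _ ⟨w, hw, rfl⟩
    rw [← hYA] at hw
    exact hw p hp
  intro A B hAB
  refine lt_of_le_not_ge ?_ fun h => hAB.not_ge (key _ _ h)
  exact vanishingIdeal_anti_mono (Set.image_mono hAB.le)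

/-- If `V` is covered by finitely many `K`-varieties whose coordinate rings have Krull dimension at
most `N`, then `dim V ≤ N`. -/
theorem dim_le_of_subset_iUnion_zeroLocus {ι : Type*} (s : Finset ι)
    (I : ι → Ideal (MvPolynomial (Fin n) K)) {V : Set (Fin n → L)} {N : WithBot ℕ∞}
    (hV : ∀ x ∈ V, ∃ i ∈ s, x ∈ zeroLocus L (I i))
    (hI : ∀ i ∈ s, ringKrullDim (MvPolynomial (Fin n) K ⧸ I i) ≤ N) :
    dim K V ≤ N := by
  let _ := zariskiTopology K L n
  refine iSup_le fun l : LTSeries (IrrClosedIn K V) => ?_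
  have hle : s.inf I ≤ (IrrClosedIn.prime l.last).asIdeal := by
    rintro p hp _ ⟨z, -, rfl⟩
    obtain ⟨i, hi, hz⟩ := hV z z.2
    exact hz p ((Finset.inf_le (f := I) hi) hp)
  -- A prime containing a finite intersection of ideals contains one of them. The largest member of
  -- the chain has the smallest prime, so the same `I i` lies below every prime of the chain.
  obtain ⟨i, hi, hle⟩ := (Ideal.IsPrime.inf_le' (IrrClosedIn.prime l.last).isPrime).1 hle
  refine le_trans ?_ (hI i hi)
  rw [ringKrullDim_quotient, ← Order.krullDim_orderDual]
  let l' : LTSeries (PrimeSpectrum.zeroLocus (I i : Set (MvPolynomial (Fin n) K)))ᵒᵈ :=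
    { length := l.length
      toFun := fun j => OrderDual.toDual ⟨IrrClosedIn.prime (l j), fun p hp =>
        (IrrClosedIn.prime_strictAnti.antitone (LTSeries.monotone l (Fin.le_last j))) (hle hp)⟩
      step := fun j => IrrClosedIn.prime_strictAnti (l.step j) }
  exact Order.LTSeries.length_le_krullDim l'

theorem dim_mono {V W : Set (Fin n → L)} (h : V ⊆ W) : dim K V ≤ dim K W := by
  let _ := zariskiTopology K L n
  exact (Topology.IsEmbedding.inclusion h).isInducing.topologicalKrullDim_le

variable [IsAlgClosed L]

theorem isIrreducible_zeroLocus (p : Ideal (MvPolynomial (Fin n) K)) [hp : p.IsPrime] :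
    @IsIrreducible _ (zariskiTopology K L n) (zeroLocus L p) := by
  rw [isIrreducible_zariski_iff, IsPrime.vanishingIdeal_zeroLocus]
  exact hp

/-- A chain of prime ideals gives a chain of irreducible varieties. -/
theorem length_le_dim (l : LTSeries (PrimeSpectrum (MvPolynomial (Fin n) K)))
    {V : Set (Fin n → L)} (hV : zeroLocus L l.head.asIdeal ⊆ V) :
    (l.length : WithBot ℕ∞) ≤ dim K V := by
  let _ := zariskiTopology K L n
  have hsub : ∀ j, zeroLocus L (l j).asIdeal ⊆ V := fun j =>
    (zeroLocus_anti_mono (LTSeries.monotone l (Fin.zero_le j))).trans hV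
  have hirr : ∀ j, IsIrreducible (Subtype.val ⁻¹' zeroLocus L (l j).asIdeal : Set V) := fun j => by
    have h := isIrreducible_zeroLocus (L := L) (l j).asIdeal
    refine ⟨?_, ?_⟩
    · obtain ⟨x, hx⟩ := h.1
      exact ⟨⟨x, hsub j hx⟩, hx⟩
    · rw [isPreirreducible_iff_isClosed_union_isClosed]
      intro A B hA hB hAB
      obtain ⟨A, hA', rfl⟩ := isClosed_induced_iff.1 hA
      obtain ⟨B, hB', rfl⟩ := isClosed_induced_iff.1 hB
      refine (isPreirreducible_iff_isClosed_union_isClosed.1 h.2 A B hA' hB'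
        fun x hx => @hAB ⟨x, hsub j hx⟩ hx).imp (fun h => ?_) (fun h => ?_) <;>
      exact fun z hz => h hz
  let A (j : Fin (l.length + 1)) : IrrClosedIn K V :=
    { carrier := Subtype.val ⁻¹' zeroLocus L (l j).asIdeal
      isIrreducible' := hirr j
      isClosed' := (isClosed_zariski_iff.2 ⟨_, rfl⟩).preimage continuous_subtype_val }
  have hA : ∀ j : Fin l.length, A j.succ < A j.castSucc := fun j => by
    have hlt : l j.castSucc < l j.succ := l.step j
    refine lt_of_le_not_ge (fun z hz => zeroLocus_anti_mono hlt.le hz) fun h => hlt.not_ge ?_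
    have h2 : zeroLocus L (l j.castSucc).asIdeal ⊆ zeroLocus L (l j.succ).asIdeal :=
      fun z hz => @h ⟨z, hsub _ hz⟩ hz
    -- Strictness survives because the Nullstellensatz recovers each prime from its zeros in `L`.
    have h3 := vanishingIdeal_anti_mono (k := K) h2
    rwa [IsPrime.vanishingIdeal_zeroLocus, IsPrime.vanishingIdeal_zeroLocus] at h3
  let l' : LTSeries (IrrClosedIn K V)ᵒᵈ := ⟨l.length, fun j => OrderDual.toDual (A j), hA⟩
  have := Order.LTSeries.length_le_krullDim l'
  rwa [Order.krullDim_orderDual] at this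

end Topology

/-! ### Minimal primes give irreducible components -/

section Components

variable {L : Type*} [Field L] [IsAlgClosed L] {n : ℕ}

theorem zeroLocus_mem_components {I q : Ideal (MvPolynomial (Fin n) L)}
    (hq : q ∈ I.minimalPrimes) : zeroLocus L q ∈ components (zeroLocus L I) := by
  have := hq.1.1
  refine ⟨⟨isIrreducible_zeroLocus q, zeroLocus_anti_mono hq.1.2⟩, fun Z hZ hle => ?_⟩
  have h1 : vanishingIdeal L Z ≤ q := by
    simpa using vanishingIdeal_anti_mono (k := L) hle
  have h2 : q ≤ vanishingIdeal L Z :=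
    hq.2 ⟨isIrreducible_zariski_iff.1 hZ.1, le_zeroLocus_iff_le_vanishingIdeal.1 hZ.2⟩ h1
  exact le_zeroLocus_iff_le_vanishingIdeal.2 h2

end Components

/-! ### Chain rule and rank of a product -/

section Jacobian

variable {K L : Type*} [Field K] [Field L] [Algebra K L]

theorem aeval_pderiv_bind₁ {s n : ℕ} (P : Fin s → MvPolynomial (Fin n) K) (x : Fin n → L)
    (k : Fin n) (f : MvPolynomial (Fin s) K) :
    aeval x (pderiv k (bind₁ P f)) =
      ∑ i, aeval (fun i => aeval x (P i)) (pderiv i f) * aeval x (pderiv k (P i)) := by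
  induction f using MvPolynomial.induction_on with
  | C a => simp
  | add p q hp hq => simp only [map_add, hp, hq, add_mul, Finset.sum_add_distrib]
  | mul_X p j hp =>
    simp only [map_mul, bind₁_X_right, Derivation.leibniz, smul_eq_mul, map_add, hp, pderiv_X,
      aeval_bind₁, aeval_X, add_mul, Finset.sum_add_distrib]
    congr 1
    · rw [Finset.sum_eq_single j]
      · simp
      · intro i _ hij
        simp [hij]
      · simp
    · rw [Finset.mul_sum]
      exact Finset.sum_congr rfl fun i _ => by ring

theorem jacobian_bind₁ {m s n : ℕ} (P : Fin s → MvPolynomial (Fin n) K)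
    (S : Fin m → MvPolynomial (Fin s) K) (x : Fin n → L) :
    jacobian (fun j => bind₁ P (S j)) x =
      jacobian S (fun i => aeval x (P i)) * jacobian P x := by
  ext j k
  simp [jacobian, Matrix.mul_apply, aeval_pderiv_bind₁]

theorem linearIndependent_row_of_rank {m n : ℕ} {M : Matrix (Fin m) (Fin n) L} (h : M.rank = m) :
    LinearIndependent L M.row := by
  rw [linearIndependent_iff_card_eq_finrank_span, Fintype.card_fin, Set.finrank,
    ← Matrix.rank_eq_finrank_span_row, h]

/-- Independent rows mean that `v ↦ v ᵥ* M` is injective, and injectivity passes to the composite.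
-/
theorem rank_mul_of_rank {m s n : ℕ} {A : Matrix (Fin m) (Fin s) L} {B : Matrix (Fin s) (Fin n) L}
    (hA : A.rank = m) (hB : LinearIndependent L B.row) : (A * B).rank = m := by
  have key : LinearIndependent L (A * B).row := by
    rw [← Matrix.vecMul_injective_iff]
    intro v w hvw
    simp only [← Matrix.vecMul_vecMul] at hvw
    exact Matrix.vecMul_injective_iff.2 (linearIndependent_row_of_rank hA)
      (Matrix.vecMul_injective_iff.2 hB hvw)
  simpa using key.rank_matrix

end Jacobian

/-! ### Jacobian of the elementary symmetric polynomials -/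

section Esymm

variable {K L : Type*} [Field K] [Field L] [Algebra K L] {n : ℕ}

theorem pderiv_prod_X_eq_zero (k : Fin n) {t : Finset (Fin n)} (ht : k ∉ t) :
    pderiv k (∏ i ∈ t, (X i : MvPolynomial (Fin n) K)) = 0 := by
  induction t using Finset.induction_on with
  | empty => simp
  | insert a t ha ih =>
    simp only [Finset.mem_insert, not_or] at ht
    rw [Finset.prod_insert ha, Derivation.leibniz, ih ht.2, pderiv_X_of_ne (Ne.symm ht.1)]
    simp

/-- The elementary symmetric polynomials in the variables other than `X k`. -/
def esymmErase (K : Type*) [Field K] {n : ℕ} (k : Fin n) (i : ℕ) : MvPolynomial (Fin n) K :=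
  ∑ t ∈ Finset.powersetCard i (Finset.univ.erase k), ∏ j ∈ t, X j

/-- Subsets of size `i + 1` are split according to whether they contain `k`. -/
theorem esymm_succ (k : Fin n) (i : ℕ) :
    esymm (Fin n) K (i + 1) = esymmErase K k (i + 1) + X k * esymmErase K k i := by
  rw [esymm, ← Finset.insert_erase (Finset.mem_univ k),
    Finset.powersetCard_succ_insert (Finset.notMem_erase k _), Finset.sum_union, esymmErase,
    esymmErase, Finset.sum_image, Finset.mul_sum]
  · congr 1
    refine Finset.sum_congr rfl fun t ht => ?_
    rw [Finset.prod_insert]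
    exact fun h => Finset.notMem_erase k _ ((Finset.mem_powersetCard.1 ht).1 h)
  · intro t ht u hu h
    have h1 : k ∉ t := fun h => Finset.notMem_erase k _ ((Finset.mem_powersetCard.1 ht).1 h)
    have h2 : k ∉ u := fun h => Finset.notMem_erase k _ ((Finset.mem_powersetCard.1 hu).1 h)
    rw [← Finset.erase_insert h1, h, Finset.erase_insert h2]
  · rw [Finset.disjoint_left]
    intro t ht hu
    obtain ⟨u, -, rfl⟩ := Finset.mem_image.1 hu
    exact Finset.notMem_erase k _ ((Finset.mem_powersetCard.1 ht).1 (Finset.mem_insert_self k u))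

theorem pderiv_esymmErase (k : Fin n) (i : ℕ) : pderiv k (esymmErase K k i) = 0 := by
  rw [esymmErase, map_sum]
  refine Finset.sum_eq_zero fun t ht => pderiv_prod_X_eq_zero k fun h => ?_
  exact Finset.notMem_erase k _ ((Finset.mem_powersetCard.1 ht).1 h)

theorem pderiv_esymm_succ (k : Fin n) (i : ℕ) :
    pderiv k (esymm (Fin n) K (i + 1)) = esymmErase K k i := by
  rw [esymm_succ k, map_add, Derivation.leibniz, pderiv_esymmErase, pderiv_esymmErase,
    pderiv_X_self]
  simp

/-- Univariate polynomials whose value at the coordinate `x k` is the elementary symmetric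
polynomial in the coordinates of `x` other than `x k`. -/
def esymmErasePoly (K : Type*) [Field K] [Algebra K L] (x : Fin n → L) : ℕ → Polynomial L
  | 0 => 1
  | i + 1 => Polynomial.C (aeval x (esymm (Fin n) K (i + 1))) -
      Polynomial.X * esymmErasePoly K x i

theorem eval_esymmErasePoly (x : Fin n → L) (k : Fin n) (i : ℕ) :
    (esymmErasePoly K x i).eval (x k) = aeval x (esymmErase K k i) := by
  induction i with
  | zero => simp [esymmErasePoly, esymmErase]
  | succ i ih =>
    rw [esymmErasePoly, Polynomial.eval_sub, Polynomial.eval_C, Polynomial.eval_mul,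
      Polynomial.eval_X, ih, esymm_succ k, map_add, map_mul, aeval_X, add_sub_cancel_right]

/-- The leading coefficient is `±1`, so the degree is exact in every characteristic. -/
theorem degree_esymmErasePoly (x : Fin n → L) (i : ℕ) :
    (esymmErasePoly K x i).degree = i := by
  induction i with
  | zero => simp [esymmErasePoly]
  | succ i ih =>
    have h : (Polynomial.X * esymmErasePoly K x i).degree = ((i + 1 : ℕ) : WithBot ℕ) := by
      rw [Polynomial.degree_mul, ih, Polynomial.degree_X, add_comm]
      rfl
    change Polynomial.degree (Polynomial.C _ - _) = _
    rw [Polynomial.degree_sub_eq_right_of_degree_lt, h]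
    rw [h]
    refine Polynomial.degree_C_le.trans_lt ?_
    exact_mod_cast Nat.succ_pos i

theorem linearIndependent_jacobian_esymm {s : ℕ} (x : Fin n → L) [DecidableEq L]
    (hx : s ≤ (Finset.univ.image x).card) :
    LinearIndependent L
      (jacobian (fun i : Fin s => esymm (Fin n) K ((i : ℕ) + 1)) x).row := by
  let Q : Polynomial.Sequence L := ⟨esymmErasePoly K x, degree_esymmErasePoly x⟩
  have hQ : LinearIndependent L fun i : Fin s => esymmErasePoly K x i :=
    Q.linearIndependent.comp _ Fin.val_injective
  rw [Fintype.linearIndependent_iff] at hQ ⊢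
  intro c hc
  -- The same coefficients `c` combine the polynomials into one of degree `< s` that vanishes at all
  -- distinct coordinates of `x`, at least `s` in number.
  refine hQ c (Polynomial.eq_zero_of_degree_lt_of_eval_finset_eq_zero (Finset.univ.image x) ?_ ?_)
  · rcases Nat.eq_zero_or_pos s with rfl | hs
    · simp
    · refine (Polynomial.degree_sum_le _ _).trans_lt ?_
      rw [Finset.sup_lt_iff (WithBot.bot_lt_coe _)]
      intro i _
      refine (Polynomial.degree_smul_le _ _).trans_lt ?_
      rw [degree_esymmErasePoly]
      exact_mod_cast i.2.trans_le hx
  · intro z hz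
    obtain ⟨k, -, rfl⟩ := Finset.mem_image.1 hz
    have := congrFun hc k
    simp only [Matrix.row, jacobian, Finset.sum_apply, Pi.smul_apply, Matrix.of_apply,
      pderiv_esymm_succ, Pi.zero_apply] at this
    simpa [Polynomial.eval_finsetSum, eval_esymmErasePoly] using this

theorem rank_jacobian_symComp {F : Type*} [Field F] [Algebra F L] {m s : ℕ}
    (S : Fin m → MvPolynomial (Fin s) F) (hS : ∀ y : Fin s → L, (jacobian S y).rank = m)
    [DecidableEq L] (x : Fin n → L) (hx : s ≤ (Finset.univ.image x).card) :
    (jacobian (symComp n S) x).rank = m := by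
  have h := jacobian_bind₁ (fun i : Fin s => esymm (Fin n) F ((i : ℕ) + 1)) S x
  change (jacobian (fun j => bind₁ _ (S j)) x).rank = m
  rw [h]
  exact rank_mul_of_rank (hS _) (linearIndependent_jacobian_esymm x hx)

end Esymm

/-! ### Points with few distinct coordinates -/

section Diagonals

variable {K L : Type*} [Field K] [Field L] [Algebra K L] {n : ℕ}

/-- The kernel is the ideal of the diagonal on which coordinates in one fibre of `π` agree; its
coordinate ring is a polynomial ring on `τ`. -/
theorem ringKrullDim_quotient_ker_rename {τ : Type*} [Finite τ] (π : Fin n → τ)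
    (hπ : Function.Surjective π) :
    ringKrullDim (MvPolynomial (Fin n) K ⧸
      RingHom.ker (rename π : MvPolynomial (Fin n) K →ₐ[K] MvPolynomial τ K)) = Nat.card τ := by
  let f : MvPolynomial (Fin n) K →ₐ[K] MvPolynomial τ K := rename π
  have e := Ideal.quotientKerAlgEquivOfSurjective (f := f) (rename_surjective π hπ)
  rw [ringKrullDim_eq_of_ringEquiv e.toRingEquiv,
    MvPolynomial.ringKrullDim_of_isNoetherianRing, ringKrullDim_eq_zero_of_field, zero_add]

/-- A set of points with fewer than `s` distinct coordinates each has dimension at most `s - 1`. -/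
theorem dim_le_of_card_image_lt [DecidableEq L] {s : ℕ} {V : Set (Fin n → L)}
    (hV : ∀ x ∈ V, (Finset.univ.image x).card < s) : dim K V ≤ ((s - 1 : ℕ) : WithBot ℕ∞) := by
  classical
  refine dim_le_of_subset_iUnion_zeroLocus
    (Finset.univ.filter fun e : Fin n → Fin n => (Finset.univ.image e).card < s)
    (fun e => RingHom.ker (rename (Set.rangeFactorization e) :
      MvPolynomial (Fin n) K →ₐ[K] MvPolynomial (Set.range e) K)) ?_ ?_
  · intro x hx
    have hex : ∀ k, ∃ l, x l = x k := fun k => ⟨k, rfl⟩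
    -- A representative index for each coordinate value. The choice depends on the value only, so
    -- `e` takes at most as many values as `x` does.
    let e : Fin n → Fin n := fun k => (hex k).choose
    have he : ∀ k, x (e k) = x k := fun k => (hex k).choose_spec
    have he' : ∀ k l, x k = x l → e k = e l := fun k l h => by
      simp only [e, h]
    refine ⟨e, ?_, ?_⟩
    · rw [Finset.mem_filter]
      refine ⟨Finset.mem_univ _, lt_of_le_of_lt ?_ (hV x hx)⟩
      refine Finset.card_le_card_of_injOn x (fun z _ => by simp) ?_
      intro a ha b hb hab
      simp only [Finset.coe_image, Finset.coe_univ, Set.image_univ, Set.mem_range] at ha hb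
      obtain ⟨a, rfl⟩ := ha
      obtain ⟨b, rfl⟩ := hb
      rw [he, he] at hab
      exact he' _ _ hab
    · intro p hp
      have : aeval (fun z : Set.range e => x z) (rename (Set.rangeFactorization e) p) =
          aeval x p := by
        rw [aeval_rename]
        congr 2
        ext k
        exact he k
      rw [← this, (RingHom.mem_ker).1 hp, map_zero]
  · intro e he
    rw [ringKrullDim_quotient_ker_rename _ Set.rangeFactorization_surjective]
    rw [Finset.mem_filter] at he
    have : Nat.card (Set.range e) = (Finset.univ.image e).card := by
      rw [← Set.ncard_coe_finset, Finset.coe_image, Finset.coe_univ, Set.image_univ]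
      rfl
    rw [this]
    exact_mod_cast Nat.le_sub_one_of_lt he.2

end Diagonals

/-! ### Tangent spaces bound heights -/

section Tangent

variable {L : Type*} [Field L] {n : ℕ}

/-- The gradient of a polynomial at a point, as a linear form. -/
def gradient (x : Fin n → L) : MvPolynomial (Fin n) L →ₗ[L] Module.Dual L (Fin n → L) where
  toFun f := ∑ k, aeval x (pderiv k f) • LinearMap.proj k
  map_add' f g := by simp [add_smul, Finset.sum_add_distrib]
  map_smul' c f := by simp [Finset.smul_sum, mul_smul]

theorem gradient_apply (x : Fin n → L) (f : MvPolynomial (Fin n) L) (v : Fin n → L) :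
    gradient x f v = ∑ k, aeval x (pderiv k f) * v k := by
  simp [gradient]

/-- The linear polynomial with prescribed gradient `φ` that vanishes at `x`. -/
def linearAt (x : Fin n → L) (φ : Module.Dual L (Fin n → L)) : MvPolynomial (Fin n) L :=
  ∑ k, C (φ (Pi.single k 1)) * (X k - C (x k))

theorem aeval_linearAt (x : Fin n → L) (φ : Module.Dual L (Fin n → L)) :
    aeval x (linearAt x φ) = 0 := by
  simp [linearAt]

theorem X_sub_C_mem (x : Fin n → L) (k : Fin n) :
    (X k - C (x k) : MvPolynomial (Fin n) L) ∈ vanishingIdeal L {x} := by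
  rw [mem_vanishingIdeal_singleton_iff]
  simp

/-- First order Taylor expansion. -/
theorem sub_linearAt_gradient_mem (x : Fin n → L) (f : MvPolynomial (Fin n) L) :
    f - C (aeval x f) - linearAt x (gradient x f) ∈ (vanishingIdeal L {x}) ^ 2 := by
  have hlin : ∀ g, linearAt x (gradient x g) =
      ∑ k, C (aeval x (pderiv k g)) * (X k - C (x k)) := fun g => by
    simp [linearAt, gradient_apply, Pi.single_apply]
  simp only [hlin]
  induction f using MvPolynomial.induction_on with
  | C a => simp
  | add p q hp hq =>
    convert add_mem hp hq using 1
    simp only [map_add, add_mul, Finset.sum_add_distrib]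
    ring
  | mul_X p j hp =>
    -- The remainder of `p * X j` is this product plus `x j` times the remainder of `p`.
    have h1 : (p - C (aeval x p)) * (X j - C (x j)) ∈ (vanishingIdeal L {x}) ^ 2 := by
      rw [pow_two]
      refine Ideal.mul_mem_mul ?_ (X_sub_C_mem x j)
      rw [mem_vanishingIdeal_singleton_iff]
      simp
    convert add_mem h1 (Ideal.mul_mem_left _ (C (x j)) hp) using 1
    have h2 : ∀ k, C (aeval x (pderiv k (p * X j))) * (X k - C (x k)) =
        C (x j) * (C (aeval x (pderiv k p)) * (X k - C (x k))) +
          if k = j then C (aeval x p) * (X j - C (x j)) else 0 := fun k => by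
      rw [Derivation.leibniz, smul_eq_mul, smul_eq_mul, map_add, map_mul, map_mul, aeval_X]
      split_ifs with h
      · subst h
        rw [pderiv_X_self, map_one, map_add, map_mul, map_mul, map_one]
        ring
      · rw [pderiv_X_of_ne (Ne.symm h), map_zero, mul_zero, zero_add, map_mul]
        ring
    simp only [h2, Finset.sum_add_distrib, Finset.sum_ite_eq', Finset.mem_univ, if_true,
      ← Finset.mul_sum, map_mul, aeval_X]
    ring

/-- The tangent space at `x` of the variety of an ideal. -/
def idealTangentSpace (I : Ideal (MvPolynomial (Fin n) L)) (x : Fin n → L) :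
    Submodule L (Fin n → L) :=
  ((I.restrictScalars L).map (gradient x)).dualCoannihilator

theorem mem_idealTangentSpace {I : Ideal (MvPolynomial (Fin n) L)} {x v : Fin n → L} :
    v ∈ idealTangentSpace I x ↔ ∀ f ∈ I, gradient x f v = 0 := by
  simp [idealTangentSpace, Submodule.mem_dualCoannihilator]

theorem tangentSpace_eq (V : Set (Fin n → L)) (x : Fin n → L) :
    tangentSpace V x = idealTangentSpace (vanishingIdeal L V) x := by
  ext v
  rw [mem_idealTangentSpace]
  simp only [tangentSpace, Submodule.mem_iInf, LinearMap.mem_ker, Matrix.mulVecLin_apply,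
    gradient_apply]
  refine forall₂_congr fun f _ => ?_
  rw [funext_iff]
  simp [Matrix.mulVec, dotProduct, jacobian]

theorem linearAt_mem_span (x : Fin n → L) {t : ℕ} (b : Fin t → Module.Dual L (Fin n → L))
    {φ : Module.Dual L (Fin n → L)} (hφ : φ ∈ Submodule.span L (Set.range b)) :
    linearAt x φ ∈ Ideal.span (Set.range fun i => linearAt x (b i)) := by
  induction hφ using Submodule.span_induction with
  | mem φ h =>
    obtain ⟨i, rfl⟩ := h
    exact Ideal.subset_span ⟨i, rfl⟩
  | zero => simp [linearAt]
  | add φ ψ _ _ h1 h2 =>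
    convert add_mem h1 h2 using 1
    simp [linearAt, add_mul, Finset.sum_add_distrib]
  | smul c φ _ h =>
    convert Ideal.mul_mem_left _ (C c) h using 1
    simp [linearAt, Finset.mul_sum, mul_assoc]

theorem exists_complementary_family {V : Type*} [AddCommGroup V] [Module L V]
    [FiniteDimensional L V] (W : Submodule L V) {t : ℕ}
    (ht : Module.finrank L W + t = Module.finrank L V) :
    ∃ b : Fin t → V, W ⊔ Submodule.span L (Set.range b) = ⊤ := by
  obtain ⟨W', hW'⟩ := Submodule.exists_isCompl W
  have h2 := Submodule.finrank_add_eq_of_isCompl hW'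
  let b := Module.finBasisOfFinrankEq L W' (n := t) (by omega)
  refine ⟨fun i => b i, ?_⟩
  have : Submodule.span L (Set.range fun i => (b i : V)) = W' := by
    have h := congrArg (Submodule.map W'.subtype) b.span_eq
    rwa [Submodule.map_span, ← Set.range_comp, Submodule.map_top, Submodule.range_subtype] at h
  rw [this, hW'.sup_eq_top]

/-- A substitute for Nakayama: the image of `m` in the domain `R ⧸ Q` is a finitely generated
idempotent ideal, hence zero or everything, and it is prime. -/
theorem le_of_le_sup_sq {R : Type*} [CommRing R] [IsNoetherianRing R] {Q m : Ideal R}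
    [Q.IsPrime] [hm : m.IsPrime] (hQm : Q ≤ m) (h : m ≤ Q ⊔ m ^ 2) : m ≤ Q := by
  have hidem : IsIdempotentElem (m.map (Ideal.Quotient.mk Q)) := by
    refine le_antisymm Ideal.mul_le_left ?_
    have := Ideal.map_mono (f := Ideal.Quotient.mk Q) h
    rwa [Ideal.map_sup, Ideal.map_quotient_self, bot_sup_eq, pow_two, Ideal.map_mul] at this
  have hM : (m.map (Ideal.Quotient.mk Q)).IsPrime := Ideal.isPrime_map_quotientMk_of_isPrime hQm
  rcases (Ideal.isIdempotentElem_iff_eq_bot_or_top _ (IsNoetherian.noetherian _)).1 hidem with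
    h | h
  · rwa [Ideal.map_eq_bot_iff_le_ker, Ideal.mk_ker] at h
  · exact absurd h hM.ne_top

/-- The height of the maximal ideal of a point in a quotient of a polynomial ring is at most the
dimension of the tangent space. -/
theorem height_le_finrank_idealTangentSpace (I : Ideal (MvPolynomial (Fin n) L)) (x : Fin n → L)
    (hx : I ≤ vanishingIdeal L {x}) :
    ((vanishingIdeal L {x}).map (Ideal.Quotient.mk I)).height ≤
      Module.finrank L (idealTangentSpace I x) := by
  set m : Ideal (MvPolynomial (Fin n) L) := vanishingIdeal L {x} with hm
  set W := (I.restrictScalars L).map (gradient x) with hW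
  -- As many linear forms as the tangent dimension complete the gradients of `I` to the whole dual
  -- space.
  obtain ⟨b, hb⟩ := exists_complementary_family W (t := Module.finrank L (idealTangentSpace I x))
    (by rw [Subspace.dual_finrank_eq]; exact Subspace.finrank_add_finrank_dualCoannihilator_eq W)
  let ℓ := fun i => linearAt x (b i)
  -- Subtracting from `f` some `g ∈ I` leaves a gradient in the span of `b`; by Taylor expansion the
  -- rest lies in `m ^ 2`.
  have hgen : m ≤ I ⊔ Ideal.span (Set.range ℓ) ⊔ m ^ 2 := by
    intro f hf
    have hmem : gradient x f ∈ W ⊔ Submodule.span L (Set.range b) := by rw [hb]; trivial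
    obtain ⟨w, hw, w', hw', hsum⟩ := Submodule.mem_sup.1 hmem
    obtain ⟨g, hg, rfl⟩ := hw
    have hg : g ∈ I := hg
    have h1 := sub_linearAt_gradient_mem x (f - g)
    have h2 : gradient x (f - g) = w' := by rw [map_sub, ← hsum, add_sub_cancel_left]
    have h3 : aeval x (f - g) = 0 := (mem_vanishingIdeal_singleton_iff x _).1 (sub_mem hf (hx hg))
    rw [h2, h3, map_zero, sub_zero] at h1
    have : f = g + linearAt x w' + (f - g - linearAt x w') := by ring
    rw [this]
    exact Submodule.add_mem_sup (Submodule.add_mem_sup hg (linearAt_mem_span x b hw')) h1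
  have hℓm : ∀ i, ℓ i ∈ m := fun i => (mem_vanishingIdeal_singleton_iff x _).2 (aeval_linearAt x _)
  let q := Ideal.Quotient.mk I
  have hprime : (m.map q).IsPrime := Ideal.isPrime_map_quotientMk_of_isPrime hx
  -- Minimality over the images of the `ℓ i` lets Krull's height theorem bound the height by their
  -- number.
  have hmin : m.map q ∈ (Ideal.span (q '' Set.range ℓ)).minimalPrimes := by
    refine ⟨⟨hprime, ?_⟩, ?_⟩
    · rw [Ideal.span_le]
      rintro _ ⟨_, ⟨i, rfl⟩, rfl⟩
      exact Ideal.mem_map_of_mem _ (hℓm i)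
    · rintro Q ⟨hQ, hQℓ⟩ hQm
      refine le_of_le_sup_sq hQm ?_
      rw [Ideal.map_le_iff_le_comap]
      refine hgen.trans (sup_le (sup_le ?_ ?_) ?_)
      · intro f hf
        rw [Ideal.mem_comap, show q f = 0 from Ideal.Quotient.eq_zero_iff_mem.2 hf]
        exact zero_mem _
      · rw [Ideal.span_le]
        rintro _ ⟨i, rfl⟩
        exact Ideal.mem_sup_left (hQℓ (Ideal.subset_span ⟨_, ⟨i, rfl⟩, rfl⟩))
      · rw [← Ideal.map_le_iff_le_comap, pow_two, pow_two, Ideal.map_mul]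
        exact le_sup_right
  refine (Ideal.height_le_card_of_mem_minimalPrimes_span
    ((Set.finite_range ℓ).image q) hmin).trans ?_
  have h1 : (q '' Set.range ℓ).ncard ≤ Module.finrank L (idealTangentSpace I x) := by
    refine (Set.ncard_image_le (Set.finite_range ℓ)).trans ?_
    rw [← Set.image_univ]
    refine (Set.ncard_image_le Set.finite_univ).trans ?_
    simp
  exact_mod_cast h1

end Tangent

/-! ### Heights of closed points -/

section Height

variable {L : Type*} [Field L] {n : ℕ}

/-- Translation of the variables by a vector. -/
def translate (a : Fin n → L) : MvPolynomial (Fin n) L ≃ₐ[L] MvPolynomial (Fin n) L :=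
  AlgEquiv.ofAlgHom (aeval fun i => X i + C (a i)) (aeval fun i => X i - C (a i))
    (by ext i; simp) (by ext i; simp)

theorem comap_translate_vanishingIdeal (a x : Fin n → L) :
    (vanishingIdeal L {x}).comap (translate a).toRingEquiv = vanishingIdeal L {x + a} := by
  ext f
  rw [Ideal.mem_comap, mem_vanishingIdeal_singleton_iff, mem_vanishingIdeal_singleton_iff]
  have : (aeval x : MvPolynomial (Fin n) L →ₐ[L] L).comp (translate a).toAlgHom =
      aeval (x + a) := by
    ext i
    simp [translate]
  rw [← this]
  rfl

variable [IsAlgClosed L]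

/-- Some maximal ideal attains the Krull dimension; it belongs to a point, and translations carry
that point to any other. -/
theorem height_vanishingIdeal_singleton (x : Fin n → L) :
    (vanishingIdeal L {x}).height = n := by
  have hdim : ringKrullDim (MvPolynomial (Fin n) L) = n := by
    rw [MvPolynomial.ringKrullDim_of_isNoetherianRing, ringKrullDim_eq_zero_of_field]
    simp
  have : FiniteRingKrullDim (MvPolynomial (Fin n) L) := by
    rw [finiteRingKrullDim_iff_ne_bot_and_top, hdim]
    refine ⟨by simp, ?_⟩
    exact fun h => ENat.natCast_ne_top n (WithBot.coe_injective h)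
  obtain ⟨p, hp, hph⟩ := Ideal.exists_isMaximal_height (R := MvPolynomial (Fin n) L)
  obtain ⟨z, rfl⟩ := eq_vanishingIdeal_singleton_of_isMaximal L hp
  rw [hdim] at hph
  have h := RingEquiv.height_comap (translate (x - z)).toRingEquiv (vanishingIdeal L {z})
  rw [comap_translate_vanishingIdeal, add_sub_cancel] at h
  rw [h]
  exact_mod_cast hph

/-- In an affine domain, outside a hypersurface there is a closed point of maximal height. -/
theorem exists_isMaximal_ringKrullDim_le_height (A : Type*) [CommRing A] [IsDomain A] [Algebra L A]
    [Algebra.FiniteType L A] {a : A} (ha : a ≠ 0) :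
    ∃ Q : Ideal A, Q.IsMaximal ∧ a ∉ Q ∧ ringKrullDim A ≤ Q.height := by
  obtain ⟨k, g, hg, hint⟩ := exists_integral_inj_algHom_of_fg L A
  let _ : Algebra (MvPolynomial (Fin k) L) A := g.toRingHom.toAlgebra
  have : Algebra.IsIntegral (MvPolynomial (Fin k) L) A := ⟨hint⟩
  -- Noether normalization makes `A` integral over a polynomial ring, so `a` divides some nonzero
  -- polynomial `b`. A maximal ideal over a point `y` with `b y ≠ 0` avoids `a`.
  have hne : (Ideal.span {a}).comap (algebraMap (MvPolynomial (Fin k) L) A) ≠ ⊥ :=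
    Ideal.IsIntegral.comap_ne_bot _ (by simpa using ha)
  obtain ⟨b, hb, hb0⟩ := Submodule.exists_mem_ne_zero_of_ne_bot hne
  obtain ⟨y, hy⟩ : ∃ y, eval y b ≠ 0 := by
    by_contra! h
    exact hb0 (MvPolynomial.funext fun y => by simpa using h y)
  have hdim : ringKrullDim A ≤ k := by
    have h1 : ringKrullDim A ≤ ringKrullDim (MvPolynomial (Fin k) L) :=
      Order.krullDim_le_of_strictMono
        (PrimeSpectrum.comap (algebraMap (MvPolynomial (Fin k) L) A))
        fun P Q hPQ => Ideal.IsIntegral.comap_lt_comap hPQ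
    rw [MvPolynomial.ringKrullDim_of_isNoetherianRing, ringKrullDim_eq_zero_of_field] at h1
    simpa using h1
  have hh := height_vanishingIdeal_singleton y
  obtain ⟨l, hl, hlk⟩ := Order.exists_series_of_le_height
    (⟨vanishingIdeal L {y}, inferInstance⟩ : PrimeSpectrum (MvPolynomial (Fin k) L)) (n := k)
    (by rw [← PrimeSpectrum.height_eq_orderHeight]; exact hh.ge)
  obtain ⟨P, hPp, hP⟩ : ∃ P : Ideal A, P.IsPrime ∧ P.LiesOver (RelSeries.head l).asIdeal := by
    obtain ⟨P, -, hP, hP2⟩ := Ideal.exists_ideal_over_prime_of_isIntegral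
      (RelSeries.head l).asIdeal (⊥ : Ideal A) (by
        have hker : RingHom.ker (algebraMap (MvPolynomial (Fin k) L) A) = ⊥ :=
          (RingHom.injective_iff_ker_eq_bot _).1 hg
        rw [← RingHom.ker_eq_comap_bot, hker]
        exact bot_le)
    exact ⟨P, hP, ⟨hP2.symm⟩⟩
  -- Going up lifts a chain of length `k` ending at `y`; its last prime lies over `y` and has height
  -- at least `k ≥ dim A`.
  obtain ⟨l', hl'k, -, hmap⟩ := Ideal.exists_ltSeries_of_hasGoingUp l P
  have hlast : PrimeSpectrum.comap (algebraMap (MvPolynomial (Fin k) L) A) l'.last = l.last := by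
    have h1 := congrArg List.getLast? hmap
    rw [List.getLast?_map, List.getLast?_eq_some_getLast l'.toList_ne_nil,
      List.getLast?_eq_some_getLast l.toList_ne_nil, RelSeries.getLast_toList,
      RelSeries.getLast_toList] at h1
    exact Option.some_injective _ h1
  have hcomap : l'.last.asIdeal.comap (algebraMap (MvPolynomial (Fin k) L) A) =
      vanishingIdeal L {y} := by
    rw [hl] at hlast
    exact congrArg PrimeSpectrum.asIdeal hlast
  refine ⟨l'.last.asIdeal, ?_, fun h => ?_, ?_⟩
  · refine Ideal.isMaximal_of_isIntegral_of_isMaximal_comap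
      (R := MvPolynomial (Fin k) L) _ ?_
    rw [hcomap]
    infer_instance
  · have : b ∈ vanishingIdeal L {y} := by
      rw [← hcomap]
      exact (Ideal.span_singleton_le_iff_mem _).2 h hb
    rw [mem_vanishingIdeal_singleton_iff] at this
    exact hy this
  · refine hdim.trans ?_
    have h1 : (k : ℕ∞) ≤ l'.last.asIdeal.height := by
      rw [PrimeSpectrum.height_eq_orderHeight, ← hlk, ← hl'k]
      exact Order.length_le_height_last
    exact_mod_cast h1

/-- An irreducible variety has points of maximal local dimension outside any hypersurface that does
not contain it. -/
theorem exists_mem_zeroLocus_ringKrullDim_le_height (P : Ideal (MvPolynomial (Fin n) L))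
    [P.IsPrime] {f : MvPolynomial (Fin n) L} (hf : f ∉ P) :
    ∃ y : Fin n → L, P ≤ vanishingIdeal L {y} ∧ aeval y f ≠ 0 ∧
      ringKrullDim (MvPolynomial (Fin n) L ⧸ P) ≤
        ((vanishingIdeal L {y}).map (Ideal.Quotient.mk P)).height := by
  obtain ⟨Q, hQ, hfQ, hdim⟩ := exists_isMaximal_ringKrullDim_le_height (L := L)
    (MvPolynomial (Fin n) L ⧸ P) (a := Ideal.Quotient.mk P f)
    (by rwa [Ne, Ideal.Quotient.eq_zero_iff_mem])
  have hmax : (Q.comap (Ideal.Quotient.mk P)).IsMaximal :=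
    Ideal.comap_isMaximal_of_surjective _ Ideal.Quotient.mk_surjective
  obtain ⟨y, hy⟩ := eq_vanishingIdeal_singleton_of_isMaximal L hmax
  refine ⟨y, ?_, ?_, ?_⟩
  · rw [← hy]
    intro p hp
    rw [Ideal.mem_comap, Ideal.Quotient.eq_zero_iff_mem.2 hp]
    exact zero_mem _
  · rw [Ne, ← mem_vanishingIdeal_singleton_iff, ← hy]
    exact hfQ
  · rwa [← hy, Ideal.map_comap_of_surjective _ Ideal.Quotient.mk_surjective]

/-- A variety defined by `m` equations has local dimension at least `n - m` at each of its points. -/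
theorem exists_ltSeries_of_mem_variety {m : ℕ} (G : Fin m → MvPolynomial (Fin n) L)
    {x : Fin n → L} (hx : x ∈ variety L G) :
    ∃ l : LTSeries (PrimeSpectrum (MvPolynomial (Fin n) L)),
      Ideal.span (Set.range G) ≤ l.head.asIdeal ∧ l.last.asIdeal = vanishingIdeal L {x} ∧
        l.length = n - m := by
  set I := Ideal.span (Set.range G) with hI
  have hGx : Set.range G ⊆ (vanishingIdeal L {x} : Ideal (MvPolynomial (Fin n) L)) := by
    rintro _ ⟨i, rfl⟩
    exact (mem_vanishingIdeal_singleton_iff x _).2 (hx i)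
  have hIx : I ≤ vanishingIdeal L {x} := Ideal.span_le.2 hGx
  -- Krull's height theorem: passing to the quotient by `m` elements lowers the height `n` by at
  -- most `m`.
  have h1 := Ideal.height_le_height_add_encard_of_subset (Set.range G) hGx
  rw [height_vanishingIdeal_singleton] at h1
  have h2 : (Set.range G).encard ≤ m := by
    rw [← Set.image_univ]
    refine (Set.encard_image_le _ _).trans ?_
    simp
  have hp : ((vanishingIdeal L {x}).map (Ideal.Quotient.mk I)).IsPrime :=
    Ideal.isPrime_map_quotientMk_of_isPrime hIx
  have h3 : ((n - m : ℕ) : ℕ∞) ≤ ((vanishingIdeal L {x}).map (Ideal.Quotient.mk I)).height := by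
    have h4 := h1.trans (add_le_add_right h2 _)
    push_cast
    exact tsub_le_iff_right.2 h4
  obtain ⟨l, hl, hlen⟩ := Order.exists_series_of_le_height
    (⟨_, hp⟩ : PrimeSpectrum (MvPolynomial (Fin n) L ⧸ I)) (n := n - m)
    (by rw [← PrimeSpectrum.height_eq_orderHeight]; exact h3)
  have hmono : StrictMono (PrimeSpectrum.comap (Ideal.Quotient.mk I)) :=
    Monotone.strictMono_of_injective (fun P Q h => Ideal.comap_mono h)
      (PrimeSpectrum.comap_injective_of_surjective _ Ideal.Quotient.mk_surjective)
  refine ⟨LTSeries.map l _ hmono, ?_, ?_, hlen⟩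
  · intro p hp
    rw [LTSeries.head_map, PrimeSpectrum.comap_asIdeal, Ideal.mem_comap,
      Ideal.Quotient.eq_zero_iff_mem.2 hp]
    exact zero_mem _
  · rw [LTSeries.last_map, hl, PrimeSpectrum.comap_asIdeal]
    change Ideal.comap _ (Ideal.map _ _) = _
    rw [Ideal.comap_map_of_surjective _ Ideal.Quotient.mk_surjective, ← RingHom.ker_eq_comap_bot,
      Ideal.mk_ker, sup_eq_left]
    exact hIx

end Height

/-! ### Jacobian criterion -/

section Smooth

theorem length_le_height_map_last {R : Type*} [CommRing R] {I : Ideal R}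
    (l : LTSeries (PrimeSpectrum R)) (hl : I ≤ l.head.asIdeal) :
    (l.length : ℕ∞) ≤ (l.last.asIdeal.map (Ideal.Quotient.mk I)).height := by
  have hle : ∀ j, I ≤ (l j).asIdeal := fun j =>
    hl.trans (LTSeries.monotone l (Fin.zero_le j))
  have hcomap : ∀ j, ((l j).asIdeal.map (Ideal.Quotient.mk I)).comap (Ideal.Quotient.mk I) =
      (l j).asIdeal := fun j => by
    rw [Ideal.comap_map_of_surjective _ Ideal.Quotient.mk_surjective, ← RingHom.ker_eq_comap_bot,
      Ideal.mk_ker, sup_eq_left]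
    exact hle j
  let l' : LTSeries (PrimeSpectrum (R ⧸ I)) :=
    { length := l.length
      toFun := fun j => ⟨_, Ideal.isPrime_map_quotientMk_of_isPrime (hle j)⟩
      step := fun j => by
        have hlt : l j.castSucc < l j.succ := l.step j
        refine lt_of_le_not_ge (Ideal.map_mono hlt.le) fun h => hlt.not_ge ?_
        have h1 := Ideal.comap_mono (f := Ideal.Quotient.mk I) h
        rwa [hcomap, hcomap] at h1 }
  have h := Order.length_le_height_last (p := l')
  rwa [← PrimeSpectrum.height_eq_orderHeight] at h

variable {L : Type*} [Field L] {n m : ℕ}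

theorem finrank_idealTangentSpace_le {I : Ideal (MvPolynomial (Fin n) L)}
    (G : Fin m → MvPolynomial (Fin n) L) (hG : ∀ i, G i ∈ I) {x : Fin n → L}
    (hx : (jacobian G x).rank = m) : Module.finrank L (idealTangentSpace I x) ≤ n - m := by
  have h1 : idealTangentSpace I x ≤ LinearMap.ker (jacobian G x).mulVecLin := by
    intro v hv
    rw [mem_idealTangentSpace] at hv
    rw [LinearMap.mem_ker]
    ext i
    simpa [gradient_apply, Matrix.mulVec, dotProduct, jacobian] using hv (G i) (hG i)
  have h2 := Submodule.finrank_mono h1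
  have h3 := LinearMap.finrank_range_add_finrank_ker (jacobian G x).mulVecLin
  change (jacobian G x).rank + _ = _ at h3
  rw [hx, Module.finrank_fin_fun] at h3
  omega

/-- The full rank locus of a Jacobian matrix contains a principal open neighbourhood of each of its
points. -/
theorem exists_aeval_ne_zero_imp_rank (G : Fin m → MvPolynomial (Fin n) L) {x : Fin n → L}
    (hx : (jacobian G x).rank = m) :
    ∃ f : MvPolynomial (Fin n) L, aeval x f ≠ 0 ∧
      ∀ y : Fin n → L, aeval y f ≠ 0 → (jacobian G y).rank = m := by
  -- Instead of choosing a minor, a constant right inverse `N` of the Jacobian at `x` is fixed; `det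
  -- (J * N)` is `1` at `x`, and where it is nonzero `J` has rank `m`.
  obtain ⟨N, hN⟩ : ∃ N : Matrix (Fin n) (Fin m) L, jacobian G x * N = 1 := by
    rw [← Matrix.mulVec_surjective_iff_exists_right_inverse]
    change Function.Surjective (jacobian G x).mulVecLin
    rw [← LinearMap.range_eq_top]
    apply Submodule.eq_top_of_finrank_eq
    rw [Module.finrank_fin_fun]
    exact hx
  let f : MvPolynomial (Fin n) L :=
    ((Matrix.of fun i j => pderiv j (G i) : Matrix (Fin m) (Fin n) (MvPolynomial (Fin n) L)) *
      (N.map C : Matrix (Fin n) (Fin m) (MvPolynomial (Fin n) L))).det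
  have hf : ∀ y : Fin n → L, aeval y f = (jacobian G y * N).det := fun y => by
    rw [← AlgHom.coe_toRingHom, RingHom.map_det, RingHom.mapMatrix_apply, Matrix.map_mul]
    congr 2
    ext i j
    simp
  refine ⟨f, ?_, fun y hy => ?_⟩
  · rw [hf, hN, Matrix.det_one]
    exact one_ne_zero
  · rw [hf] at hy
    refine le_antisymm ((jacobian G y).rank_le_height) ?_
    have h1 := Matrix.rank_of_isUnit (jacobian G y * N)
      ((Matrix.isUnit_iff_isUnit_det _).2 hy.isUnit)
    have h2 := Matrix.rank_mul_le_left (jacobian G y) N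
    rw [h1, Fintype.card_fin] at h2
    exact h2

theorem variety_eq_zeroLocus (G : Fin m → MvPolynomial (Fin n) L) :
    variety L G = zeroLocus L (Ideal.span (Set.range G)) := by
  rw [zeroLocus_span]
  ext x
  simp [variety]

variable [IsAlgClosed L]

/-- The height at `x` itself is not compared with `dim Z`. The argument moves to a point `y` of `Z`
where the rank is still `m` and the height reaches the dimension, and bounds that height by the
tangent space. -/
theorem dim_le_of_mem_components (G : Fin m → MvPolynomial (Fin n) L) {x : Fin n → L}
    (hx : (jacobian G x).rank = m) {Z : Set (Fin n → L)} (hZ : Z ∈ components (variety L G))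
    (hxZ : x ∈ Z) : dim L Z ≤ ((n - m : ℕ) : WithBot ℕ∞) := by
  have hP : (vanishingIdeal L Z).IsPrime := isIrreducible_zariski_iff.1 hZ.1.1
  obtain ⟨f, hfx, hf⟩ := exists_aeval_ne_zero_imp_rank G hx
  obtain ⟨y, hy, hfy, hdim⟩ := exists_mem_zeroLocus_ringKrullDim_le_height (vanishingIdeal L Z)
    (f := f) (fun h => hfx (h x hxZ))
  have hdim2 : dim L Z ≤ ringKrullDim (MvPolynomial (Fin n) L ⧸ vanishingIdeal L Z) :=
    dim_le_of_subset_iUnion_zeroLocus {()} (fun _ => vanishingIdeal L Z)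
      (fun z hz => ⟨(), by simp, zeroLocus_vanishingIdeal_le Z hz⟩) (fun _ _ => le_rfl)
  refine hdim2.trans (hdim.trans ?_)
  have h1 := (height_le_finrank_idealTangentSpace _ y hy).trans (Nat.cast_le.2
    (finrank_idealTangentSpace_le (I := vanishingIdeal L Z) G (fun i z hz => hZ.1.2 hz i)
      (hf y hfy)))
  exact WithBot.coe_le_coe.2 h1

/-- Jacobian criterion: a variety defined by `m` equations is nonsingular at each of its points
where the Jacobian matrix has rank `m`. -/
theorem finrank_tangentSpace_eq_dimAt (G : Fin m → MvPolynomial (Fin n) L) {x : Fin n → L}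
    (hxV : x ∈ variety L G) (hx : (jacobian G x).rank = m) :
    ((Module.finrank L (tangentSpace (variety L G) x) : ℕ) : WithBot ℕ∞) =
      dimAt (variety L G) x := by
  obtain ⟨l, hlG, hlx, hlen⟩ := exists_ltSeries_of_mem_variety G hxV
  -- The component of `q` passes through `x` and contains the whole chain of varieties, so its
  -- dimension is at least `n - m`.
  obtain ⟨q, hq, hql⟩ := Ideal.exists_minimalPrimes_le hlG
  have hqp : q.IsPrime := hq.1.1
  have hcomp : zeroLocus L q ∈ components (variety L G) := by
    rw [variety_eq_zeroLocus]
    exact zeroLocus_mem_components hq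
  have hxq : x ∈ zeroLocus L q := by
    intro p hp
    rw [← mem_vanishingIdeal_singleton_iff, ← hlx]
    exact (LTSeries.head_le_last l) (hql hp)
  have hdimAt : dimAt (variety L G) x = ((n - m : ℕ) : WithBot ℕ∞) := by
    refine le_antisymm (iSup₂_le fun Z hZ => dim_le_of_mem_components G hx hZ.1 hZ.2) ?_
    refine le_trans ?_ (le_iSup₂_of_le (zeroLocus L q) ⟨hcomp, hxq⟩ le_rfl)
    rw [← hlen]
    exact length_le_dim l (zeroLocus_anti_mono hql)
  rw [hdimAt, tangentSpace_eq]
  have hle := finrank_idealTangentSpace_le (I := vanishingIdeal L (variety L G)) G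
    (fun i z hz => hz i) hx
  have hIl : vanishingIdeal L (variety L G) ≤ l.head.asIdeal := by
    refine le_trans ?_ hql
    have h1 := vanishingIdeal_anti_mono (k := L) hcomp.1.2
    rwa [IsPrime.vanishingIdeal_zeroLocus] at h1
  -- The same chain, read modulo the full vanishing ideal, bounds the tangent dimension from below.
  have hge := length_le_height_map_last l hIl
  rw [hlx, hlen] at hge
  have hge := Nat.cast_le.1 (hge.trans (height_le_finrank_idealTangentSpace _ x
    (vanishingIdeal_anti_mono (Set.singleton_subset_iff.2 hxV))))
  rw [le_antisymm hle hge]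

end Smooth

/-! ### From coefficients in `F` to coefficients in `L` -/

section BaseChange

variable {F L : Type*} [Field F] [Field L] [Algebra F L] {n m : ℕ}

theorem variety_map (G : Fin m → MvPolynomial (Fin n) F) :
    variety L (fun i => map (algebraMap F L) (G i)) = variety L G := by
  ext x
  simp [variety, aeval_map_algebraMap]

theorem jacobian_map (G : Fin m → MvPolynomial (Fin n) F) (x : Fin n → L) :
    jacobian (fun i => map (algebraMap F L) (G i)) x = jacobian G x := by
  ext i j
  simp only [jacobian, Matrix.of_apply, pderiv_map, aeval_map_algebraMap]

theorem rank_jacobian_ne_of_mem_singularLocus [IsAlgClosed L] (G : Fin m → MvPolynomial (Fin n) F)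
    {x : Fin n → L} (hx : x ∈ singularLocus (variety L G)) : (jacobian G x).rank ≠ m := by
  intro h
  rw [← jacobian_map] at h
  rw [← variety_map] at hx
  exact hx.2 (finrank_tangentSpace_eq_dimAt _ hx.1 h)

end BaseChange

end SymSing

end

theorem mainTheorem7 {F L : Type*} [Field F] [Finite F] [Field L] [Algebra F L] [IsAlgClosure F L]
    (s d r : ℕ) (hs : 1 ≤ s) (hsd : s ≤ d - 2) (hd : 2 * (s + 1) ≤ d)
    (hr : d - s + 1 ≤ r) (hrd : r ≤ d)
    (S : Fin (r + s - d) → MvPolynomial (Fin s) F)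
    (H1 : RingTheory.Sequence.IsWeaklyRegular (MvPolynomial (Fin s) F) (List.ofFn S))
    (H2 : ∀ y : Fin s → L, (SymSing.jacobian S y).rank = r + s - d) :
    (SymSing.dim F {x : Fin r → L |
        (SymSing.jacobian (SymSing.symComp r S) x).rank ≠ r + s - d} ≤ ((s - 1 : ℕ) : WithBot ℕ∞) ∧
      SymSing.dim L {x : Fin r → L |
        (SymSing.jacobian (SymSing.symComp r S) x).rank ≠ r + s - d} ≤ ((s - 1 : ℕ) : WithBot ℕ∞)) ∧
    (SymSing.dim F (SymSing.singularLocus (SymSing.variety L (SymSing.symComp r S))) ≤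
        ((s - 1 : ℕ) : WithBot ℕ∞) ∧
      SymSing.dim L (SymSing.singularLocus (SymSing.variety L (SymSing.symComp r S))) ≤
        ((s - 1 : ℕ) : WithBot ℕ∞)) := by
  classical
  have : IsAlgClosed L := IsAlgClosure.isAlgClosed F
  have hV : ∀ x ∈ {x : Fin r → L |
      (SymSing.jacobian (SymSing.symComp r S) x).rank ≠ r + s - d},
      (Finset.univ.image x).card < s := fun x hx => by
    by_contra! h
    exact hx (SymSing.rank_jacobian_symComp S H2 x h)
  have hsing : SymSing.singularLocus (SymSing.variety L (SymSing.symComp r S)) ⊆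
      {x : Fin r → L | (SymSing.jacobian (SymSing.symComp r S) x).rank ≠ r + s - d} :=
    fun x hx => SymSing.rank_jacobian_ne_of_mem_singularLocus _ hx
  -- The diagonals are defined over any coefficient field, so one covering serves both topologies.
  have hF := SymSing.dim_le_of_card_image_lt (K := F) hV
  have hL := SymSing.dim_le_of_card_image_lt (K := L) hV
  exact ⟨⟨hF, hL⟩, (SymSing.dim_mono hsing).trans hF, (SymSing.dim_mono hsing).trans hL⟩
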